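/- There is an absolute constant $C>0$ such that the following holds. Let $Y$ be any set and let $S:[0,1]\times Y\to\mathbb R$ be a scoring function such that, for every $y\in Y$, the function $p\mapsto S(p,y)$ is convex and $1$-Lipschitz on $[0,1]$. For predictions $p_1,\dots,p_T\in[0,1]$ and outcomes $y_1,\dots,y_T\in Y$ define the calibration error \[ \mathsf{CAL}_S(p_{1:T};y_{1:T})=\sum_{p\in\{p_1,\dots,p_T\}} n_p\Big(\mathbb E_{y\sim\tau_p}S(p,y)-\inf_{p^*\in[0,1]}\mathbb E_{y\sim\tau_p}S(p^*,y)\Big), \] where $n_p=|\{t: p_t=p\}|$ and $\tau_p$ is the distribution of $y_t$ for $t$ uniform in $\{t:p_t=p\}$. Consider the $T$-round game in which, in round $t$, the predictor chooses a distribution $\rho_t$ on $[0,1]$ depending on the past transcript $(p_1,y_1,\dots,p_{t-1},y_{t-1})$; an adversary, who knows the predictor's strategy and the past transcript but not $p_t$, chooses $y_t\in Y$; and $p_t$ is drawn from $\rho_t$. Then for every integer $T\ge 2$ there is a randomized prediction strategy (which may depend on $S$ and $T$) such that, against every adaptive adversary, \[ \mathbb E\big[\mathsf{CAL}_S(p_{1:T};y_{1:T})\big]\le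 C\sqrt T\,\log T . \] In particular, with $Y=[0,1]$, for every $T\ge2$ there are randomized prediction strategies with this guarantee for median calibration, $S(p,y)=|p-y|$, and, for every $q\in[0,1]$, for $q$-quantile calibration, $S(p,y)=\mathbb I[y\ge p]\,q\,(y-p)+\mathbb I[y\le p]\,(1-q)\,(p-y)$. -/

import Mathlib

noncomputable section

/-- The expectation `E_{x ∼ τ} f x` of a real function under a discrete distribution. -/
def PMFExpect {α : Type*} (τ : PMF α) (f : α → ℝ) : ℝ :=
  ∑' x, (τ x).toReal * f x

/-! ### Scoring functions and calibration error

A scoring function on `[0,1] × Y` is represented by `S : ℝ → Y → ℝ`; only its values `S p y` with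
`p ∈ [0,1]` are ever used. -/

/-- The score `S p y` is a convex and `1`-Lipschitz function of `p ∈ [0,1]` for every `y`. -/
def IsConvexLipschitzScore {Y : Type*} (S : ℝ → Y → ℝ) : Prop :=
  ∀ y : Y, ConvexOn ℝ (Set.Icc (0 : ℝ) 1) (fun p => S p y) ∧
    LipschitzOnWith 1 (fun p => S p y) (Set.Icc (0 : ℝ) 1)

/-- The sub-optimality of the report `p` with respect to the distribution `τ` of the outcome. -/
def subopt {Y : Type*} (S : ℝ → Y → ℝ) (τ : PMF Y) (p : unitInterval) : ℝ :=
  PMFExpect τ (fun y => S p y) - ⨅ r : unitInterval, PMFExpect τ (fun y => S r y)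

/-- The set of rounds in which the prediction equals `q`. -/
def roundsWith {T : ℕ} (p : Fin T → unitInterval) (q : unitInterval) : Finset (Fin T) :=
  Finset.univ.filter (fun t => p t = q)

theorem roundsWith_nonempty {T : ℕ} (p : Fin T → unitInterval) {q : unitInterval}
    (hq : q ∈ Finset.univ.image p) : (roundsWith p q).Nonempty := by
  obtain ⟨t, -, ht⟩ := Finset.mem_image.1 hq
  exact ⟨t, by simp [roundsWith, ht]⟩

/-- The distribution of the outcome `y t` when `t` is sampled uniformly from the rounds in which
the prediction equals `q`. -/
def outcomeDist {Y : Type*} {T : ℕ} (p : Fin T → unitInterval) (y : Fin T → Y)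
    (q : unitInterval) (hq : q ∈ Finset.univ.image p) : PMF Y :=
  (PMF.uniformOfFinset (roundsWith p q) (roundsWith_nonempty p hq)).map y

/-- The calibration error: the sum, over the distinct predictions `q`, of the number of rounds in
which `q` is predicted times the sub-optimality of `q` for the outcomes of these rounds. -/
def CAL {Y : Type*} (S : ℝ → Y → ℝ) {T : ℕ} (p : Fin T → unitInterval) (y : Fin T → Y) : ℝ :=
  ∑ q ∈ (Finset.univ.image p).attach,
    ((roundsWith p q.1).card : ℝ) * subopt S (outcomeDist p y q.1 q.2) q.1

/-- The scoring function that elicits the median. -/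
def medianScore (p : ℝ) (y : unitInterval) : ℝ := |p - y|

/-- The scoring function that elicits the `q`-quantile. -/
def quantileScore (q : ℝ) (p : ℝ) (y : unitInterval) : ℝ :=
  (if p ≤ (y : ℝ) then q * ((y : ℝ) - p) else 0) +
    (if (y : ℝ) ≤ p then (1 - q) * (p - (y : ℝ)) else 0)

/-! ### The prediction game -/

/-- The predictions and outcomes of the first `t` rounds. -/
abbrev Transcript (Y : Type*) (t : ℕ) := Fin t → unitInterval × Y

/-- A randomized prediction strategy: after `t` rounds it chooses, from the transcript so far, the
distribution on `[0,1]` from which the next prediction is drawn. -/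
abbrev PredictionStrategy (Y : Type*) := (t : ℕ) → Transcript Y t → PMF unitInterval

/-- An adaptive adversary: after `t` rounds it chooses, from the transcript so far but without
seeing the next prediction, the next outcome. -/
abbrev Adversary (Y : Type*) := (t : ℕ) → Transcript Y t → Y

/-- The law of the transcript of the first `t` rounds of the game. -/
def transcriptLaw {Y : Type*} (ρ : PredictionStrategy Y) (A : Adversary Y) :
    (t : ℕ) → PMF (Transcript Y t)
  | 0 => PMF.pure (fun i => i.elim0)
  | t + 1 => (transcriptLaw ρ A t).bind fun h =>
      (ρ t h).map fun p => Fin.snoc (α := fun _ => unitInterval × Y) h (p, A t h)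

/-- The calibration error of a transcript. -/
def transcriptCAL {Y : Type*} (S : ℝ → Y → ℝ) {T : ℕ} (h : Transcript Y T) : ℝ :=
  CAL S (fun t => (h t).1) (fun t => (h t).2)

/-- The strategy `ρ` guarantees that the expected calibration error after `T` rounds exists and is
at most `B`, whatever the adaptive adversary does. -/
def GuaranteesCAL {Y : Type*} (S : ℝ → Y → ℝ) (T : ℕ) (ρ : PredictionStrategy Y) (B : ℝ) : Prop :=
  ∀ A : Adversary Y,
    Summable (fun h : Transcript Y T => (transcriptLaw ρ A T h).toReal * transcriptCAL S h) ∧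
      PMFExpect (transcriptLaw ρ A T) (transcriptCAL S) ≤ B

end

/-! ### Dyadic weights on the grid -/

/-! Predictions are restricted to the points `q / n` with `n = 2 ^ K` of order `√T`, and an outcome
is seen only through the slopes of its score on the `n` cells, a monotone sequence in `[-1, 1]`. The
regret of `q` against another grid point is a sum of signed slopes, so it suffices to control, for
every pair `(q, j)`, the signed slope `j` accumulated over the rounds that predict `q`. Each index
has a scale `w = gridWidth n q` and a learning rate `1 / (2 * w)`. In a window of at most `12 * w`
slopes around `q`, every round gets an allowance of order `1 / w`; this costs `O(1 / n)` regret per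
round. `exists_isGoodIndex` shows that every monotone slope sequence has a good index: inside the
window its signed slopes are small, outside they are negative enough to pay the second-order term of
the exponential. The exponential weights of a good index therefore do not grow. Slope sequences form
a convex set, so separation (`exists_stdSimplex_sum_mul_nonpos`) turns a good index for each
sequence into one random prediction valid against all of them, and the expected potential never
increases. It starts at `2 * ∑ w = O(n log n)`, since every dyadic scale contributes at most `n`.
Thus the expected error is at most `25 * T / n + O(n log n)`. -/

/-- The width attached to the grid index `q`: the largest power of two dividing both `q` and `n`,
when `n` is a power of two. -/
def gridWidth (n q : ℕ) : ℕ := q.gcd n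

/-- The index `j` of a slope lies within `6` widths of the grid index `q`. -/
def InWindow (n q j : ℕ) : Prop := q ≤ j + 6 * gridWidth n q ∧ j < q + 6 * gridWidth n q

/-- The sign with which the slope of index `j` contributes to the regret of the grid index `q`. -/
noncomputable def slopeSign (q j : ℕ) : ℝ := if q ≤ j then -1 else 1

/-- The grid index `q` is a good response to the slopes `d` of a convex function. -/
def IsGoodIndex (n : ℕ) (d : ℕ → ℝ) (q : ℕ) : Prop :=
  ∀ j < n, (InWindow n q j → slopeSign q j * d j ≤ 1 / gridWidth n q) ∧
    (¬ InWindow n q j → slopeSign q j * d j ≤ -(1 / (2 * gridWidth n q)))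

/-- The slope sequences of convex `1`-Lipschitz functions on a grid of `n` cells. -/
def slopeSet (n : ℕ) : Set (ℕ → ℝ) :=
  {d | (∀ i j, i ≤ j → j < n → d i ≤ d j) ∧ ∀ j < n, |d j| ≤ 1}

theorem gridWidth_pos {n : ℕ} (hn : 0 < n) (q : ℕ) : 0 < gridWidth n q :=
  Nat.gcd_pos_of_pos_right _ hn

theorem gridWidth_odd_mul {K v : ℕ} (hv : v ≤ K) (i : ℕ) :
    gridWidth (2 ^ K) (2 ^ v + 2 * 2 ^ v * i) = 2 ^ v := by
  obtain ⟨k, rfl⟩ := Nat.exists_eq_add_of_le hv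
  have h1 : 2 ^ v + 2 * 2 ^ v * i = 2 ^ v * (2 * i + 1) := by ring
  have h2 : Nat.Coprime (2 * i + 1) (2 ^ k) := by
    apply Nat.Coprime.pow_right
    exact Nat.coprime_two_right.2 ⟨i, rfl⟩
  rw [gridWidth, h1, pow_add, Nat.gcd_mul_left, h2.gcd_eq_one, mul_one]

/-- The width is one of the powers `2 ^ v` dividing `q`, and below `2 ^ K` there are `2 ^ (K - v)`
multiples of `2 ^ v`, so each of the `K + 1` scales contributes at most `2 ^ K`. This is the source
of the logarithm in the final bound. -/
theorem sum_gridWidth_le (K : ℕ) :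
    ∑ q ∈ Finset.range (2 ^ K), (gridWidth (2 ^ K) q : ℝ) ≤ (K + 1) * 2 ^ K := by
  have key : ∀ q : ℕ, (gridWidth (2 ^ K) q) ≤
      ∑ v ∈ Finset.range (K + 1), if 2 ^ v ∣ q then 2 ^ v else 0 := by
    intro q
    obtain ⟨v, hv, hw⟩ := (Nat.dvd_prime_pow Nat.prime_two).1 (Nat.gcd_dvd_right q (2 ^ K))
    have hdvd : 2 ^ v ∣ q := hw ▸ Nat.gcd_dvd_left q (2 ^ K)
    have := Finset.single_le_sum (f := fun v => if 2 ^ v ∣ q then 2 ^ v else 0)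
      (fun i _ => Nat.zero_le _) (Finset.mem_range.2 (Nat.lt_succ_of_le hv))
    simp only [hdvd, if_true] at this
    rw [gridWidth, hw]
    exact this
  have count : ∀ v ∈ Finset.range (K + 1),
      ∑ q ∈ Finset.range (2 ^ K), (if 2 ^ v ∣ q then 2 ^ v else 0) ≤ 2 ^ K := by
    intro v hv
    obtain ⟨k, rfl⟩ := Nat.exists_eq_add_of_le (Nat.lt_succ_iff.1 (Finset.mem_range.1 hv))
    rw [← Finset.sum_filter, Finset.sum_const, smul_eq_mul]
    have hsub : (Finset.range (2 ^ (v + k))).filter (fun q => 2 ^ v ∣ q) ⊆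
        (Finset.range (2 ^ k)).image (fun i => 2 ^ v * i) := by
      intro q hq
      obtain ⟨hq, i, rfl⟩ := Finset.mem_filter.1 hq
      refine Finset.mem_image.2 ⟨i, ?_, rfl⟩
      rw [Finset.mem_range, pow_add] at hq
      exact Finset.mem_range.2 (Nat.lt_of_mul_lt_mul_left hq)
    have hcard := (Finset.card_le_card hsub).trans Finset.card_image_le
    rw [Finset.card_range] at hcard
    calc _ ≤ 2 ^ k * 2 ^ v := Nat.mul_le_mul_right _ hcard
      _ = 2 ^ (v + k) := by ring
  have : ∑ q ∈ Finset.range (2 ^ K), gridWidth (2 ^ K) q ≤ (K + 1) * 2 ^ K := by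
    calc _ ≤ ∑ q ∈ Finset.range (2 ^ K),
          ∑ v ∈ Finset.range (K + 1), (if 2 ^ v ∣ q then 2 ^ v else 0) :=
          Finset.sum_le_sum fun q _ => key q
      _ = ∑ v ∈ Finset.range (K + 1),
          ∑ q ∈ Finset.range (2 ^ K), (if 2 ^ v ∣ q then 2 ^ v else 0) := Finset.sum_comm
      _ ≤ ∑ v ∈ Finset.range (K + 1), 2 ^ K := Finset.sum_le_sum count
      _ = (K + 1) * 2 ^ K := by simp
  exact_mod_cast this

/-! ### Existence of a good grid index -/

/-- Here `m` marks the minimum of the convex function and `q` lies at most `2 * w` to its right.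
Steepness is known outside `[α, β)`, which contains `m` up to its right end and has length at most
`4 * w`; leaving the window of radius `6 * w = 2 * w + 4 * w` therefore means leaving `[α, β)` on
the appropriate side. Inside the window monotonicity reduces everything to the slope at `q - 1`. -/
theorem isGoodIndex_of_le {n m q α β w : ℕ} {d : ℕ → ℝ} (hd : d ∈ slopeSet n)
    (hpos : ∀ j, m ≤ j → j < n → 0 ≤ d j) (hw : gridWidth n q = w) (hw0 : 0 < w)
    (hqn : q < n) (hmq : m ≤ q) (hqm : q ≤ m + 2 * w) (hαm : α ≤ m) (hmβ : m ≤ β)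
    (hαβ : β ≤ α + 4 * w) (hβ : ∀ j, β ≤ j → j < n → 1 / (2 * w : ℝ) < d j)
    (hα : ∀ j < α, d j < -(1 / (2 * w : ℝ))) (hq : 0 < q) (hdq : d (q - 1) ≤ 1 / w) :
    IsGoodIndex n d q := by
  have hw' : (0 : ℝ) < 1 / w := by positivity
  intro j hj
  unfold InWindow slopeSign
  rw [hw]
  split_ifs with h
  · refine ⟨fun _ => ?_, fun hwin => ?_⟩
    · linarith [hpos j (hmq.trans h) hj]
    · linarith [hβ j (by omega) hj]
  · refine ⟨fun _ => ?_, fun hwin => ?_⟩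
    · linarith [hd.1 j (q - 1) (by omega) (by omega)]
    · linarith [hα j (by omega)]

theorem isGoodIndex_of_ge {n m q α β w : ℕ} {d : ℕ → ℝ} (hd : d ∈ slopeSet n)
    (hneg : ∀ j < m, d j ≤ 0) (hw : gridWidth n q = w) (hw0 : 0 < w)
    (hmq : q ≤ m) (hqm : m ≤ q + 2 * w) (hαm : α ≤ m) (hmβ : m ≤ β)
    (hαβ : β ≤ α + 4 * w) (hβ : ∀ j, β ≤ j → j < n → 1 / (2 * w : ℝ) < d j)
    (hα : ∀ j < α, d j < -(1 / (2 * w : ℝ))) (hdq : -(1 / w) ≤ d q) :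
    IsGoodIndex n d q := by
  have hw' : (0 : ℝ) < 1 / w := by positivity
  intro j hj
  unfold InWindow slopeSign
  rw [hw]
  split_ifs with h
  · refine ⟨fun _ => ?_, fun hwin => ?_⟩
    · linarith [hd.1 q j h hj]
    · linarith [hβ j (by omega) hj]
  · refine ⟨fun _ => ?_, fun hwin => ?_⟩
    · linarith [hneg j (by omega)]
    · linarith [hα j (by omega)]

/-- If no grid index is good, then the slopes are steep outside an interval around the minimum, at
every dyadic scale. -/
theorem steep_of_not_isGoodIndex {K m : ℕ} {d : ℕ → ℝ} (hd : d ∈ slopeSet (2 ^ K))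
    (hm : m ≤ 2 ^ K) (hneg : ∀ j < m, d j ≤ 0) (hpos : ∀ j, m ≤ j → j < 2 ^ K → 0 ≤ d j)
    (hbad : ∀ q < 2 ^ K, ¬ IsGoodIndex (2 ^ K) d q) (i : ℕ) :
    ∀ v, v + i = K → ∃ α β : ℕ, α ≤ m ∧ m ≤ β ∧ β ≤ 2 ^ K ∧ β ≤ α + 2 * 2 ^ v ∧
      (∀ j, β ≤ j → j < 2 ^ K → 1 / (2 ^ v : ℝ) < d j) ∧
      ∀ j < α, d j < -(1 / (2 ^ v : ℝ)) := by
  induction i with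
  | zero =>
    rintro v rfl
    -- At the coarsest scale the interval is the whole grid and steepness is vacuous.
    refine ⟨0, 2 ^ v, Nat.zero_le _, hm, le_rfl, by omega, fun j h1 h2 => ?_,
      fun j hj => ?_⟩
    · simp at h2; omega
    · omega
  | succ i ih =>
    intro v hv
    obtain ⟨α, β, hαm, hmβ, hβn, hαβ, hβ, hα⟩ := ih (v + 1) (by omega)
    have hK : 2 * 2 ^ v ≤ 2 ^ K := by
      rw [← pow_succ']
      exact Nat.pow_le_pow_right (by norm_num) (by omega)
    have hw0 : 0 < 2 ^ v := by positivity
    have hodd := gridWidth_odd_mul (K := K) (v := v) (by omega)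
    have hcast : ((2 ^ v : ℕ) : ℝ) = 2 ^ v := by push_cast; rfl
    rw [pow_succ'] at hαβ hβ hα
    rw [← hcast] at hβ hα ⊢
    generalize 2 ^ v = w at *
    -- The odd multiples of `w` are the indices of width exactly `w`. One near `m` on the right
    -- fails to be good only if all slopes from it onwards exceed `1 / w`, which doubles the
    -- steepness known from the previous scale.
    have right : ∀ i, m ≤ w + 2 * w * i → w + 2 * w * i ≤ m + 2 * w → w + 2 * w * i < 2 ^ K →
        ∀ j, w + 2 * w * i ≤ j → j < 2 ^ K → 1 / (w : ℝ) < d j := by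
      intro i h1 h2 h3 j h4 h5
      by_contra! hle
      exact hbad _ h3 (isGoodIndex_of_le hd hpos (hodd i) hw0 h3 h1 h2 hαm hmβ (by omega) hβ hα
        (by omega) ((hd.1 _ j (by omega) h5).trans hle))
    have left : ∀ i, w + 2 * w * i ≤ m → m ≤ w + 2 * w * i + 2 * w → w + 2 * w * i < 2 ^ K →
        ∀ j < w + 2 * w * i, d j < -(1 / (w : ℝ)) := by
      intro i h1 h2 h3 j h4
      by_contra! hle
      exact hbad _ h3 (isGoodIndex_of_ge hd hneg (hodd i) hw0 h1 h2 hαm hmβ (by omega) hβ hα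
        (hle.trans (hd.1 j _ h4.le h3)))
    rcases lt_or_ge m w with hmw | hmw
    · exact ⟨0, w, Nat.zero_le _, hmw.le, by omega, by omega,
        by simpa using right 0 (by omega) (by omega) (by omega), fun j hj => by omega⟩
    -- The new endpoints are the consecutive odd multiples of `w` surrounding `m`, the right one
    -- truncated at the end of the grid.
    · have hdiv := Nat.div_add_mod (m - w) (2 * w)
      have hmod := Nat.mod_lt (m - w) (show 0 < 2 * w by omega)
      set i := (m - w) / (2 * w)
      have hnext : w + 2 * w * (i + 1) = w + 2 * w * i + 2 * w := by ring
      refine ⟨w + 2 * w * i, min (2 ^ K) (w + 2 * w * i + 2 * w), by omega, by omega, by omega,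
        by omega, fun j hj hjK => ?_, fun j hj => ?_⟩
      · have := right (i + 1)
        rw [hnext] at this
        exact this (by omega) (by omega) (by omega) j (by omega) hjK
      · rcases lt_or_ge (w + 2 * w * i) (2 ^ K) with hlt | hge
        · exact left i (by omega) (by omega) hlt j hj
        -- The end of the grid has width `2 ^ K ≥ 2 * w`, so it is not an odd multiple of `w`.
        · have heq : w + 2 * w * i = 2 ^ K := by omega
          have := hodd i
          rw [heq, gridWidth, Nat.gcd_self] at this
          omega

theorem exists_isGoodIndex {K : ℕ} (hK : 2 ≤ K) {d : ℕ → ℝ} (hd : d ∈ slopeSet (2 ^ K)) :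
    ∃ q < 2 ^ K, IsGoodIndex (2 ^ K) d q := by
  by_contra! hbad
  have h4 : 2 ^ 2 ≤ 2 ^ K := Nat.pow_le_pow_right (by norm_num) hK
  have hex : ∃ m, ∀ j, m ≤ j → j < 2 ^ K → 0 ≤ d j := ⟨2 ^ K, fun j h1 h2 => by omega⟩
  classical
  -- At scale `v = 0` slopes exceed `1` in absolute value outside an interval of length `2`,
  -- impossible on a grid of at least four cells.
  obtain ⟨α, β, hαm, hmβ, hβn, hαβ, hβ, hα⟩ := steep_of_not_isGoodIndex hd
    (Nat.find_min' hex fun j h1 h2 => by omega)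
    (fun j hj => by
      by_contra! hlt
      have := Nat.find_min' hex (m := j) fun i h1 h2 => hlt.le.trans (hd.1 j i h1 h2)
      omega)
    (Nat.find_spec hex) hbad K 0 (by omega)
  simp only [pow_zero, div_one, mul_one] at hαβ hβ hα
  have hα0 : α = 0 := by
    by_contra h0
    have h1 := hα 0 (by omega)
    have h2 := abs_le.1 (hd.2 0 (by omega))
    linarith [h2.1]
  have h1 := hβ β le_rfl (by omega)
  have h2 := abs_le.1 (hd.2 β (by omega))
  linarith [h2.2]

/-! ### The minimax step -/

/-- The hypothesis says that `C` misses the open positive orthant. A separating functional has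
coefficients of one sign, and normalising them gives the mixed strategy. Openness of the orthant
makes closedness of `C` unnecessary. -/
theorem exists_stdSimplex_sum_mul_nonpos {ι : Type*} [Fintype ι] {C : Set (ι → ℝ)}
    (hC : Convex ℝ C) (hne : C.Nonempty) (h : ∀ b ∈ C, ∃ i, b i ≤ 0) :
    ∃ ρ ∈ stdSimplex ℝ ι, ∀ b ∈ C, ∑ i, ρ i * b i ≤ 0 := by
  classical
  set P : Set (ι → ℝ) := Set.univ.pi fun _ => Set.Ioi 0 with hP
  have hPo : IsOpen P := isOpen_set_pi Set.finite_univ fun _ _ => isOpen_Ioi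
  have hPc : Convex ℝ P := convex_pi fun _ _ => convex_Ioi 0
  have hdisj : Disjoint P C := by
    rw [Set.disjoint_left]
    intro b hb hbC
    obtain ⟨i, hi⟩ := h b hbC
    exact absurd (hb i trivial) (not_lt.2 hi)
  obtain ⟨f, u, hfP, hfC⟩ := geometric_hahn_banach_open hPc hPo hC hdisj
  set g : ι → ℝ := fun i => - f (Pi.single i 1) with hg
  have hf : ∀ b, f b = - ∑ i, g i * b i := by
    intro b
    conv_lhs => rw [pi_eq_sum_univ' b]
    simp [hg, mul_comm]
  -- The functional tends to `0` along small positive constant vectors.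
  have hu : 0 ≤ u := by
    by_contra! hlt
    have hpos : 0 < -u / (2 * (|∑ i, g i| + 1)) := div_pos (by linarith) (by positivity)
    have h1 := hfP (fun _ => -u / (2 * (|∑ i, g i| + 1))) (fun _ _ => hpos)
    rw [hf, ← Finset.sum_mul, neg_lt] at h1
    have h2 : (∑ i, g i) * (-u / (2 * (|∑ i, g i| + 1))) ≤
        (|∑ i, g i| + 1) * (-u / (2 * (|∑ i, g i| + 1))) := by
      gcongr
      linarith [le_abs_self (∑ i, g i)]
    have h3 : (|∑ i, g i| + 1) * (-u / (2 * (|∑ i, g i| + 1))) = -u / 2 := by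
      field_simp
    linarith
  have hg0 : ∀ i, 0 ≤ g i := by
    intro i
    by_contra! hlt
    -- With `g i < 0`, a step of this size along coordinate `i` would push the functional to `u` or
    -- above inside the orthant.
    have hs : 0 ≤ (|u| + |∑ k, g k|) / -g i := div_nonneg (by positivity) (by linarith)
    have h1 := hfP (fun k => 1 + if k = i then (|u| + |∑ k, g k|) / -g i else 0)
      (fun k _ => by
        simp only [Set.mem_Ioi]
        split_ifs <;> linarith)
    rw [hf] at h1
    simp only [mul_add, mul_one, mul_ite, mul_zero, Finset.sum_add_distrib, Finset.sum_ite_eq',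
      Finset.mem_univ, if_true] at h1
    have h2 : g i * ((|u| + |∑ k, g k|) / -g i) = -(|u| + |∑ k, g k|) := by
      rw [div_neg, mul_neg, mul_div_cancel₀ _ hlt.ne]
    rw [h2] at h1
    linarith [le_abs_self u, le_abs_self (∑ k, g k)]
  have hsum : 0 < ∑ i, g i := by
    refine (Finset.sum_nonneg fun i _ => hg0 i).lt_of_ne fun h0 => ?_
    have hz := (Finset.sum_eq_zero_iff_of_nonneg fun i _ => hg0 i).1 h0.symm
    obtain ⟨b, hb⟩ := hne
    have h1 := hfP (fun _ => 1) fun _ _ => Set.mem_Ioi.2 one_pos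
    have h2 := hfC b hb
    rw [hf, Finset.sum_eq_zero fun i hi => by rw [hz i hi, zero_mul]] at h1 h2
    linarith
  refine ⟨fun i => g i / ∑ k, g k, ⟨fun i => div_nonneg (hg0 i) hsum.le, ?_⟩, fun b hb => ?_⟩
  · rw [← Finset.sum_div, div_self hsum.ne']
  · have := hfC b hb
    rw [hf] at this
    have h2 : ∑ i, g i / (∑ k, g k) * b i = (∑ i, g i * b i) / ∑ k, g k := by
      rw [Finset.sum_div]
      exact Finset.sum_congr rfl fun i _ => by ring
    rw [h2]
    exact div_nonpos_of_nonpos_of_nonneg (by linarith) hsum.le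

/-! ### Finitely supported expectations -/

section FiniteSupport

variable {α β : Type*}

theorem PMFExpect_eq_sum {τ : PMF α} {s : Finset α} (hs : τ.support ⊆ s) (f : α → ℝ) :
    PMFExpect τ f = ∑ x ∈ s, (τ x).toReal * f x := by
  refine tsum_eq_sum fun x hx => ?_
  have : τ x = 0 := by
    by_contra h
    exact hx (hs ((PMF.mem_support_iff τ x).2 h))
  simp [this]

theorem summable_toReal_mul_of_finite_support {τ : PMF α} (hτ : τ.support.Finite) (f : α → ℝ) :
    Summable fun x => (τ x).toReal * f x := by
  refine summable_of_ne_finset_zero (s := hτ.toFinset) fun x hx => ?_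
  have : τ x = 0 := by
    by_contra h
    exact hx (hτ.mem_toFinset.2 ((PMF.mem_support_iff τ x).2 h))
  simp [this]

theorem sum_toReal_eq_one {τ : PMF α} {s : Finset α} (hs : τ.support ⊆ s) :
    ∑ x ∈ s, (τ x).toReal = 1 := by
  rw [← ENNReal.toReal_sum fun x _ => τ.apply_ne_top x, ← ENNReal.toReal_one, ← τ.tsum_coe]
  congr 1
  refine (tsum_eq_sum fun x hx => ?_).symm
  by_contra h
  exact hx (hs ((PMF.mem_support_iff τ x).2 h))

theorem PMFExpect_mono {τ : PMF α} (hτ : τ.support.Finite) {f g : α → ℝ}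
    (h : ∀ x ∈ τ.support, f x ≤ g x) : PMFExpect τ f ≤ PMFExpect τ g := by
  rw [PMFExpect_eq_sum hτ.coe_toFinset.ge, PMFExpect_eq_sum hτ.coe_toFinset.ge]
  exact Finset.sum_le_sum fun x hx =>
    mul_le_mul_of_nonneg_left (h x (hτ.mem_toFinset.1 hx)) ENNReal.toReal_nonneg

theorem PMFExpect_const_add {τ : PMF α} (hτ : τ.support.Finite) (c : ℝ) (f : α → ℝ) :
    PMFExpect τ (fun x => c + f x) = c + PMFExpect τ f := by
  rw [PMFExpect_eq_sum hτ.coe_toFinset.ge, PMFExpect_eq_sum hτ.coe_toFinset.ge]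
  simp only [mul_add, Finset.sum_add_distrib]
  rw [← Finset.sum_mul, sum_toReal_eq_one hτ.coe_toFinset.ge, one_mul]

theorem PMFExpect_pure (a : α) (f : α → ℝ) : PMFExpect (PMF.pure a) f = f a := by
  rw [PMFExpect_eq_sum (s := {a}) (by simp)]
  simp

theorem finite_support_bind {τ : PMF α} {g : α → PMF β} (hτ : τ.support.Finite)
    (hg : ∀ a, (g a).support.Finite) : (τ.bind g).support.Finite := by
  rw [PMF.support_bind]
  exact hτ.biUnion fun a _ => hg a

theorem PMFExpect_bind {τ : PMF α} {g : α → PMF β} (hτ : τ.support.Finite)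
    (hg : ∀ a, (g a).support.Finite) (f : β → ℝ) :
    PMFExpect (τ.bind g) f = PMFExpect τ fun a => PMFExpect (g a) f := by
  have hb := finite_support_bind hτ hg
  have hsub : ∀ a ∈ hτ.toFinset, (g a).support ⊆ hb.toFinset := by
    intro a ha b hgb
    rw [Finset.mem_coe, hb.mem_toFinset, PMF.mem_support_bind_iff]
    exact ⟨a, hτ.mem_toFinset.1 ha, hgb⟩
  rw [PMFExpect_eq_sum hτ.coe_toFinset.ge, PMFExpect_eq_sum hb.coe_toFinset.ge]
  have h1 : ∀ b, ((τ.bind g) b).toReal =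
      ∑ a ∈ hτ.toFinset, (τ a).toReal * (g a b).toReal := by
    intro b
    rw [PMF.bind_apply, tsum_eq_sum (s := hτ.toFinset), ENNReal.toReal_sum]
    · simp [ENNReal.toReal_mul]
    · exact fun a _ => ENNReal.mul_ne_top (τ.apply_ne_top a) ((g a).apply_ne_top b)
    · intro a ha
      have : τ a = 0 := by
        by_contra h
        exact ha (hτ.mem_toFinset.2 ((PMF.mem_support_iff τ a).2 h))
      simp [this]
  simp only [h1, Finset.sum_mul]
  rw [Finset.sum_comm]
  refine Finset.sum_congr rfl fun a ha => ?_
  rw [PMFExpect_eq_sum (hsub a ha), Finset.mul_sum]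
  exact Finset.sum_congr rfl fun b _ => by ring

theorem PMFExpect_map {τ : PMF α} (g : α → β) (hτ : τ.support.Finite) (f : β → ℝ) :
    PMFExpect (τ.map g) f = PMFExpect τ (f ∘ g) := by
  rw [← PMF.bind_pure_comp, PMFExpect_bind hτ (fun a => by simp)]
  simp only [Function.comp_apply, PMFExpect_pure]
  rfl

/-- The distribution with the given vector of probabilities. -/
noncomputable def simplexPMF {ι : Type*} [Fintype ι] (ρ : ι → ℝ) (hρ : ρ ∈ stdSimplex ℝ ι) : PMF ι :=
  PMF.ofFintype (fun i => ENNReal.ofReal (ρ i)) (by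
    rw [← ENNReal.ofReal_sum_of_nonneg fun i _ => hρ.1 i, hρ.2, ENNReal.ofReal_one])

theorem PMFExpect_simplexPMF {ι : Type*} [Fintype ι] (ρ : ι → ℝ) (hρ : ρ ∈ stdSimplex ℝ ι)
    (f : ι → ℝ) : PMFExpect (simplexPMF ρ hρ) f = ∑ i, ρ i * f i := by
  rw [PMFExpect_eq_sum (s := Finset.univ) (by simp)]
  exact Finset.sum_congr rfl fun i _ => by
    rw [simplexPMF, PMF.ofFintype_apply, ENNReal.toReal_ofReal (hρ.1 i)]

end FiniteSupport

/-! ### The exponential potential -/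

/-- The learning rate of the grid index `q`. -/
noncomputable def gridRate (n q : ℕ) : ℝ := 1 / (2 * gridWidth n q)

instance (n q j : ℕ) : Decidable (InWindow n q j) := by
  unfold InWindow
  infer_instance

/-- The compensated contribution of a slope `x` of index `j` to the grid index `q`. -/
noncomputable def slopeGain (n q j : ℕ) (x : ℝ) : ℝ :=
  slopeSign q j * x - if InWindow n q j then 4 * gridRate n q else 0

theorem gridRate_pos {n : ℕ} (hn : 0 < n) (q : ℕ) : 0 < gridRate n q := by
  have := gridWidth_pos hn q
  unfold gridRate
  positivity

theorem gridRate_le {n : ℕ} (hn : 0 < n) (q : ℕ) : gridRate n q ≤ 1 := by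
  have : (1 : ℝ) ≤ gridWidth n q := by exact_mod_cast gridWidth_pos hn q
  unfold gridRate
  rw [div_le_one (by linarith)]
  linarith

theorem abs_slopeSign (q j : ℕ) : |slopeSign q j| = 1 := by
  unfold slopeSign
  split_ifs <;> simp

/-- A majorant of `exp (gridRate n q * slopeGain n q j x)` which is affine in `x`. -/
noncomputable def affineGain (n q j : ℕ) (x : ℝ) : ℝ :=
  Real.exp (-(gridRate n q * if InWindow n q j then 4 * gridRate n q else 0)) *
    (1 + gridRate n q * (slopeSign q j * x) + gridRate n q ^ 2)

/-- For `|z| ≤ 1` one has `exp z ≤ 1 + z + z ^ 2`, and the square is at most the squared rate.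
Replacing it by this constant makes the bound affine in the slope, as the minimax step requires. -/
theorem exp_slopeGain_le {n : ℕ} (hn : 0 < n) (q j : ℕ) {x : ℝ} (hx : |x| ≤ 1) :
    Real.exp (gridRate n q * slopeGain n q j x) ≤ affineGain n q j x := by
  have hr := gridRate_pos hn q
  have hr1 := gridRate_le hn q
  have hsx : |slopeSign q j * x| ≤ 1 := by rwa [abs_mul, abs_slopeSign, one_mul]
  have hz : |gridRate n q * (slopeSign q j * x)| ≤ gridRate n q := by
    rw [abs_mul, abs_of_pos hr]
    exact mul_le_of_le_one_right hr.le hsx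
  have hexp := (abs_le.1 (Real.abs_exp_sub_one_sub_id_le (hz.trans hr1))).2
  have hsq := sq_le_sq' (abs_le.1 hz).1 (abs_le.1 hz).2
  unfold slopeGain affineGain
  rw [mul_sub, sub_eq_neg_add, Real.exp_add]
  exact mul_le_mul_of_nonneg_left (by linarith) (Real.exp_pos _).le

/-- Write `η` for the rate. Inside the window the signed slope is at most `2 * η`, and `1 + 3 * η ^
2 ≤ exp (4 * η ^ 2)`; outside it is at most `-η`, which cancels `η ^ 2`. -/
theorem affineGain_le_one {n q j : ℕ} {d : ℕ → ℝ} (hn : 0 < n) (h : IsGoodIndex n d q)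
    (hj : j < n) : affineGain n q j (d j) ≤ 1 := by
  have hr := gridRate_pos hn q
  have hw : (1 : ℝ) / gridWidth n q = 2 * gridRate n q := by
    unfold gridRate
    have := gridWidth_pos hn q
    field_simp
  obtain ⟨h1, h2⟩ := h j hj
  unfold affineGain
  split_ifs with hwin
  · have h3 := h1 hwin
    rw [hw] at h3
    rw [Real.exp_neg, inv_mul_le_one₀ (Real.exp_pos _)]
    refine le_trans ?_ (Real.add_one_le_exp _)
    nlinarith
  · have h3 : _ ≤ -gridRate n q := h2 hwin
    rw [mul_zero, neg_zero, Real.exp_zero, one_mul]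
    nlinarith

theorem convex_slopeSet (n : ℕ) : Convex ℝ (slopeSet n) := by
  intro d hd e he a b ha hb hab
  refine ⟨fun i j hij hj => ?_, fun j hj => ?_⟩
  · simp only [Pi.add_apply, Pi.smul_apply, smul_eq_mul]
    exact add_le_add (mul_le_mul_of_nonneg_left (hd.1 i j hij hj) ha)
      (mul_le_mul_of_nonneg_left (he.1 i j hij hj) hb)
  · have h1 := abs_le.1 (hd.2 j hj)
    have h2 := abs_le.1 (he.2 j hj)
    simp only [Pi.add_apply, Pi.smul_apply, smul_eq_mul]
    rw [abs_le]
    constructor <;> nlinarith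

/-- There is a distribution on the grid for which every weighted exponential potential decreases
in expectation, whatever slopes are revealed. -/
theorem exists_stdSimplex_potential_nonincreasing {K : ℕ} (hK : 2 ≤ K) (a : Fin (2 ^ K) → ℕ → ℝ)
    (ha : ∀ q j, 0 ≤ a q j) :
    ∃ ρ ∈ stdSimplex ℝ (Fin (2 ^ K)), ∀ d ∈ slopeSet (2 ^ K),
      ∑ q, ρ q * ∑ j ∈ Finset.range (2 ^ K),
        a q j * (Real.exp (gridRate (2 ^ K) q * slopeGain (2 ^ K) q j (d j)) - 1) ≤ 0 := by
  have hn : 0 < 2 ^ K := by positivity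
  set L : (ℕ → ℝ) → Fin (2 ^ K) → ℝ := fun d q =>
    ∑ j ∈ Finset.range (2 ^ K), a q j * (affineGain (2 ^ K) q j (d j) - 1) with hL
  -- `L` is affine in `d`, so it preserves convexity; the exponential itself would not.
  have hconv : Convex ℝ (L '' slopeSet (2 ^ K)) := by
    rintro _ ⟨d, hd, rfl⟩ _ ⟨e, he, rfl⟩ s t hs ht hst
    refine ⟨s • d + t • e, convex_slopeSet _ hd he hs ht hst, ?_⟩
    funext q
    simp only [hL, Pi.add_apply, Pi.smul_apply, smul_eq_mul, Finset.mul_sum,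
      ← Finset.sum_add_distrib, affineGain]
    refine Finset.sum_congr rfl fun j _ => ?_
    obtain rfl : t = 1 - s := by linarith
    ring
  obtain ⟨ρ, hρ, h⟩ := exists_stdSimplex_sum_mul_nonpos hconv
    ⟨_, 0, ⟨fun _ _ _ _ => le_rfl, fun _ _ => by simp⟩, rfl⟩ (by
      rintro _ ⟨d, hd, rfl⟩
      obtain ⟨q, hq, hgood⟩ := exists_isGoodIndex hK hd
      -- A good index makes every summand nonpositive at once, whatever the weights `a`.
      refine ⟨⟨q, hq⟩, Finset.sum_nonpos fun j hj => ?_⟩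
      exact mul_nonpos_of_nonneg_of_nonpos (ha _ _)
        (by linarith [affineGain_le_one hn hgood (Finset.mem_range.1 hj)]))
  refine ⟨ρ, hρ, fun d hd => le_trans ?_ (h _ ⟨d, hd, rfl⟩)⟩
  refine Finset.sum_le_sum fun q _ => mul_le_mul_of_nonneg_left ?_ (hρ.1 q)
  refine Finset.sum_le_sum fun j hj => mul_le_mul_of_nonneg_left ?_ (ha q j)
  linarith [exp_slopeGain_le hn q j (hd.2 j (Finset.mem_range.1 hj))]

/-! ### The strategy -/

section Game

variable {Y : Type*}

/-- The total compensated gain of the rounds of the transcript `h` with prediction `p`. -/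
noncomputable def bucketGain (n : ℕ) (d : Y → ℕ → ℝ) {t : ℕ} (h : Transcript Y t) (p : unitInterval)
    (q j : ℕ) : ℝ :=
  ∑ s : Fin t, if (h s).1 = p then slopeGain n q j (d (h s).2 j) else 0

/-- The contribution of one slope of one grid index to the potential. -/
noncomputable def bucketPotential (n : ℕ) (d : Y → ℕ → ℝ) {t : ℕ} (h : Transcript Y t) (p : unitInterval)
    (q j : ℕ) : ℝ :=
  1 / (gridRate n q * n) * Real.exp (gridRate n q * bucketGain n d h p q j)

/-- The potential of a transcript. -/
noncomputable def potential (n : ℕ) (pos : Fin n → unitInterval) (d : Y → ℕ → ℝ) {t : ℕ}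
    (h : Transcript Y t) : ℝ :=
  ∑ q : Fin n, ∑ j ∈ Finset.range n, bucketPotential n d h (pos q) q j

theorem bucketPotential_snoc {n : ℕ} (d : Y → ℕ → ℝ) {t : ℕ} (h : Transcript Y t)
    (p p' : unitInterval) (y : Y) (q j : ℕ) :
    bucketPotential n d (Fin.snoc (α := fun _ => unitInterval × Y) h (p', y) :
      Transcript Y (t + 1)) p q j = bucketPotential n d h p q j +
        if p' = p then bucketPotential n d h p q j *
          (Real.exp (gridRate n q * slopeGain n q j (d y j)) - 1) else 0 := by
  unfold bucketPotential bucketGain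
  rw [Fin.sum_univ_castSucc]
  simp only [Fin.snoc_castSucc, Fin.snoc_last]
  split_ifs
  · rw [mul_add, Real.exp_add]
    ring
  · simp

theorem potential_snoc {n : ℕ} {pos : Fin n → unitInterval} (hpos : Function.Injective pos)
    (d : Y → ℕ → ℝ) {t : ℕ} (h : Transcript Y t) (y : Y) (q : Fin n) :
    potential n pos d (Fin.snoc (α := fun _ => unitInterval × Y) h (pos q, y) :
      Transcript Y (t + 1)) = potential n pos d h + ∑ j ∈ Finset.range n,
        bucketPotential n d h (pos q) q j *
          (Real.exp (gridRate n q * slopeGain n q j (d y j)) - 1) := by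
  unfold potential
  simp only [bucketPotential_snoc, Finset.sum_add_distrib, hpos.eq_iff]
  congr 1
  rw [Finset.sum_comm]
  simp

theorem bucketPotential_nonneg {n : ℕ} (hn : 0 < n) (d : Y → ℕ → ℝ) {t : ℕ} (h : Transcript Y t)
    (p : unitInterval) (q j : ℕ) : 0 ≤ bucketPotential n d h p q j := by
  have := gridRate_pos hn q
  unfold bucketPotential
  positivity

theorem potential_zero_le {K : ℕ} (pos : Fin (2 ^ K) → unitInterval) (d : Y → ℕ → ℝ)
    (h : Transcript Y 0) : potential (2 ^ K) pos d h ≤ 2 * ((K + 1) * 2 ^ K) := by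
  have hterm : ∀ q : Fin (2 ^ K), ∑ j ∈ Finset.range (2 ^ K),
      bucketPotential (2 ^ K) d h (pos q) q j = 2 * gridWidth (2 ^ K) q := by
    intro q
    have hw := gridWidth_pos (n := 2 ^ K) (by positivity) q
    simp only [bucketPotential, bucketGain, Finset.univ_eq_empty, Finset.sum_empty, mul_zero,
      Real.exp_zero, Finset.sum_const, Finset.card_range, nsmul_eq_mul, gridRate]
    field_simp
  unfold potential
  rw [Finset.sum_congr rfl fun q _ => hterm q, ← Finset.mul_sum,
    Fin.sum_univ_eq_sum_range (fun q => (gridWidth (2 ^ K) q : ℝ))]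
  exact mul_le_mul_of_nonneg_left (sum_gridWidth_le K) (by norm_num)

/-- A strategy which predicts on the grid and keeps the expected potential from increasing. -/
theorem exists_strategy_potential_le {K : ℕ} (hK : 2 ≤ K) {pos : Fin (2 ^ K) → unitInterval}
    (hpos : Function.Injective pos) {d : Y → ℕ → ℝ} (hd : ∀ y, d y ∈ slopeSet (2 ^ K)) :
    ∃ ρ : PredictionStrategy Y, ∀ (A : Adversary Y) (t : ℕ),
      (transcriptLaw ρ A t).support.Finite ∧
      (∀ h ∈ (transcriptLaw ρ A t).support, ∀ s, (h s).1 ∈ Set.range pos) ∧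
      PMFExpect (transcriptLaw ρ A t) (potential (2 ^ K) pos d) ≤ 2 * ((K + 1) * 2 ^ K) := by
  choose ρ hρ hstep using fun (t : ℕ) (h : Transcript Y t) =>
    exists_stdSimplex_potential_nonincreasing hK
      (fun q j => bucketPotential (2 ^ K) d h (pos q) q j)
      (fun q j => bucketPotential_nonneg (by positivity) d h (pos q) q j)
  refine ⟨fun t h => (simplexPMF (ρ t h) (hρ t h)).map pos, fun A t => ?_⟩
  induction t with
  | zero =>
    refine ⟨by simp [transcriptLaw], fun h _ s => s.elim0, ?_⟩
    rw [transcriptLaw, PMFExpect_pure]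
    exact potential_zero_le pos d _
  | succ t ih =>
    obtain ⟨hfin, hgrid, hle⟩ := ih
    rw [transcriptLaw]
    have hfin' : ∀ h : Transcript Y t, (((simplexPMF (ρ t h) (hρ t h)).map pos).map
        fun p => (Fin.snoc (α := fun _ => unitInterval × Y) h (p, A t h) :
          Transcript Y (t + 1))).support.Finite := by
      intro h
      rw [PMF.support_map, PMF.support_map]
      exact (Set.toFinite _).image _ |>.image _
    refine ⟨finite_support_bind hfin hfin', fun h' hh' s => ?_, ?_⟩
    · obtain ⟨h, hh, hm⟩ := (PMF.mem_support_bind_iff _ _ _).1 hh'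
      rw [PMF.support_map, PMF.support_map] at hm
      obtain ⟨_, ⟨q, -, rfl⟩, rfl⟩ := hm
      refine Fin.lastCases ?_ (fun i => ?_) s
      · simp
      · simpa using hgrid h hh i
    · rw [PMFExpect_bind hfin hfin']
      refine (PMFExpect_mono hfin fun h _ => ?_).trans hle
      rw [PMF.map_comp, PMFExpect_map _ (Set.toFinite _), PMFExpect_simplexPMF]
      simp only [Function.comp_apply, potential_snoc hpos, mul_add, Finset.sum_add_distrib,
        ← Finset.sum_mul, (hρ t h).2, one_mul]
      linarith [hstep t h (d (A t h)) (hd _)]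

end Game

/-! ### From the potential to the calibration error -/

/-- The slopes of the score on the grid of `n` cells. -/
noncomputable def gridSlope {Y : Type*} (S : ℝ → Y → ℝ) (n : ℕ) (y : Y) (j : ℕ) : ℝ :=
  n * (S ((j + 1 : ℕ) / n) y - S ((j : ℕ) / n) y)

/-- The point `q / n` of the unit interval. -/
noncomputable def gridPoint (n : ℕ) (q : Fin n) : unitInterval :=
  ⟨(q : ℕ) / n, by positivity, by
    rw [div_le_one (by exact_mod_cast q.pos)]
    exact_mod_cast q.isLt.le⟩

theorem gridPoint_injective (n : ℕ) : Function.Injective (gridPoint n) := by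
  intro a b hab
  have hn : (n : ℝ) ≠ 0 := by exact_mod_cast a.pos.ne'
  have h : ((a : ℕ) : ℝ) / n = (b : ℕ) / n := congrArg Subtype.val hab
  rw [div_left_inj' hn] at h
  exact Fin.ext (by exact_mod_cast h)

theorem natCast_div_mem_Icc {n j : ℕ} (hj : j ≤ n) : (j / n : ℝ) ∈ Set.Icc (0 : ℝ) 1 :=
  ⟨by positivity, div_le_one_of_le₀ (by exact_mod_cast hj) (by positivity)⟩

theorem IsConvexLipschitzScore.abs_sub_le {Y : Type*} {S : ℝ → Y → ℝ}
    (hS : IsConvexLipschitzScore S) (y : Y) {a b : ℝ} (ha : a ∈ Set.Icc (0 : ℝ) 1)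
    (hb : b ∈ Set.Icc (0 : ℝ) 1) : |S a y - S b y| ≤ |a - b| := by
  have := (hS y).2.dist_le_mul a ha b hb
  simpa [Real.dist_eq] using this

theorem gridSlope_mem_slopeSet {Y : Type*} {S : ℝ → Y → ℝ} (hS : IsConvexLipschitzScore S)
    (n : ℕ) (y : Y) : gridSlope S n y ∈ slopeSet n := by
  have hstep : ∀ j, j + 1 < n → gridSlope S n y j ≤ gridSlope S n y (j + 1) := by
    intro j hj
    have hn : (n : ℝ) ≠ 0 := by
      have : n ≠ 0 := by omega
      exact_mod_cast this
    have h := (hS y).1.2 (natCast_div_mem_Icc (n := n) (j := j) (by omega))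
      (natCast_div_mem_Icc (n := n) (j := j + 1 + 1) (by omega))
      (show (0 : ℝ) ≤ 1 / 2 by norm_num) (show (0 : ℝ) ≤ 1 / 2 by norm_num) (by norm_num)
    have hmid : (1 / 2 : ℝ) • ((j : ℕ) / n : ℝ) + (1 / 2 : ℝ) • ((j + 1 + 1 : ℕ) / n : ℝ) =
        (j + 1 : ℕ) / n := by
      simp only [smul_eq_mul]
      push_cast
      field_simp
      ring
    simp only [hmid] at h
    simp only [smul_eq_mul] at h
    unfold gridSlope
    refine mul_le_mul_of_nonneg_left ?_ (Nat.cast_nonneg n)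
    linarith
  refine ⟨fun i j hij => ?_, fun j hj => ?_⟩
  · induction j, hij using Nat.le_induction with
    | base => exact fun _ => le_rfl
    | succ j hij ih => exact fun hj => (ih (by omega)).trans (hstep j hj)
  · have hn : (0 : ℝ) < n := by
      have : 0 < n := by omega
      exact_mod_cast this
    have h := hS.abs_sub_le y (natCast_div_mem_Icc (n := n) (j := j + 1) hj)
      (natCast_div_mem_Icc hj.le)
    have h1 : ((j + 1 : ℕ) / n - (j : ℕ) / n : ℝ) = 1 / n := by
      push_cast
      ring
    rw [h1, abs_of_pos (show (0 : ℝ) < 1 / n by positivity)] at h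
    unfold gridSlope
    rw [abs_mul, abs_of_pos hn]
    calc (n : ℝ) * _ ≤ n * (1 / n) := mul_le_mul_of_nonneg_left h hn.le
      _ = 1 := mul_one_div_cancel hn.ne'

theorem sum_Ico_gridSlope {Y : Type*} (S : ℝ → Y → ℝ) (n : ℕ) (y : Y) {a b : ℕ} (hab : a ≤ b) :
    ∑ j ∈ Finset.Ico a b, gridSlope S n y j = n * (S ((b : ℕ) / n) y - S ((a : ℕ) / n) y) := by
  induction b, hab using Nat.le_induction with
  | base => simp
  | succ b hab ih =>
    rw [Finset.sum_Ico_succ_top hab, ih, gridSlope]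
    ring

/-- The regret of the grid index `q` against a grid index is a partial sum of signed slopes. -/
theorem exists_sum_slopeSign_eq {n q m : ℕ} (hq : q ≤ n) (hm : m ≤ n) :
    ∃ J ⊆ Finset.range n, ∀ {Y : Type*} (S : ℝ → Y → ℝ) (y : Y),
      n * (S ((q : ℕ) / n) y - S ((m : ℕ) / n) y) =
        ∑ j ∈ J, slopeSign q j * gridSlope S n y j := by
  rcases le_total q m with h | h
  · refine ⟨Finset.Ico q m, fun j hj => ?_, fun S y => ?_⟩
    · have := Finset.mem_Ico.1 hj
      exact Finset.mem_range.2 (by omega)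
    · have : ∀ j ∈ Finset.Ico q m, slopeSign q j * gridSlope S n y j = -gridSlope S n y j := by
        intro j hj
        rw [slopeSign, if_pos (Finset.mem_Ico.1 hj).1, neg_one_mul]
      rw [Finset.sum_congr rfl this, Finset.sum_neg_distrib, sum_Ico_gridSlope S n y h]
      ring
  · refine ⟨Finset.Ico m q, fun j hj => ?_, fun S y => ?_⟩
    · have := Finset.mem_Ico.1 hj
      exact Finset.mem_range.2 (by omega)
    · have : ∀ j ∈ Finset.Ico m q, slopeSign q j * gridSlope S n y j = gridSlope S n y j := by
        intro j hj
        rw [slopeSign, if_neg (not_le.2 (Finset.mem_Ico.1 hj).2), one_mul]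
      rw [Finset.sum_congr rfl this, sum_Ico_gridSlope S n y h]

/-- At most `12 * w` slopes lie in the window, each with allowance `4 / (2 * w)`, so the total is
independent of the scale. -/
theorem sum_window_le {n : ℕ} (hn : 0 < n) (q : ℕ) :
    ∑ j ∈ Finset.range n, (if InWindow n q j then 4 * gridRate n q else 0) ≤ 24 := by
  have hw := gridWidth_pos hn q
  rw [← Finset.sum_filter, Finset.sum_const, nsmul_eq_mul]
  have hsub : (Finset.range n).filter (fun j => InWindow n q j) ⊆
      Finset.Ico (q - 6 * gridWidth n q) (q + 6 * gridWidth n q) := by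
    intro j hj
    obtain ⟨-, h1, h2⟩ := Finset.mem_filter.1 hj
    exact Finset.mem_Ico.2 ⟨by omega, h2⟩
  have hcard := Finset.card_le_card hsub
  rw [Nat.card_Ico] at hcard
  have hcard' : (((Finset.range n).filter fun j => InWindow n q j).card : ℝ) ≤
      12 * gridWidth n q := by
    have : ((Finset.range n).filter fun j => InWindow n q j).card ≤ 12 * gridWidth n q := by omega
    exact_mod_cast this
  have hr := gridRate_pos hn q
  calc _ ≤ 12 * gridWidth n q * (4 * gridRate n q) :=
        mul_le_mul_of_nonneg_right hcard' (by positivity)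
    _ = 24 := by
      have : (0 : ℝ) < gridWidth n q := by exact_mod_cast hw
      unfold gridRate
      field_simp
      norm_num

section Transcript

variable {Y : Type*} {S : ℝ → Y → ℝ} {n T : ℕ}

theorem sum_slopeSign_bucket (d : Y → ℕ → ℝ) (h : Transcript Y T) (p : unitInterval) (q j : ℕ) :
    ∑ s ∈ roundsWith (fun t => (h t).1) p, slopeSign q j * d (h s).2 j =
      (roundsWith (fun t => (h t).1) p).card *
        (if InWindow n q j then 4 * gridRate n q else 0) + bucketGain n d h p q j := by
  rw [bucketGain, ← Finset.sum_filter]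
  change _ = _ + ∑ s ∈ roundsWith (fun t => (h t).1) p, _
  simp only [slopeGain, Finset.sum_sub_distrib, Finset.sum_const, nsmul_eq_mul]
  ring

/-- Since `x ≤ exp (η * x) / η`, each slope's gain is bounded by its potential. These bounds are
nonnegative, so the comparator-dependent set `J` can be enlarged to all slopes. -/
theorem sum_slopeSign_bucket_le (hn : 0 < n) (d : Y → ℕ → ℝ) (h : Transcript Y T)
    (p : unitInterval) (q : ℕ) {J : Finset ℕ} (hJ : J ⊆ Finset.range n) :
    ∑ j ∈ J, ∑ s ∈ roundsWith (fun t => (h t).1) p, slopeSign q j * d (h s).2 j ≤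
      24 * (roundsWith (fun t => (h t).1) p).card +
        n * ∑ j ∈ Finset.range n, bucketPotential n d h p q j := by
  have hr := gridRate_pos hn q
  have hn' : (0 : ℝ) < n := by exact_mod_cast hn
  set N : ℝ := ((Finset.card (roundsWith (fun t => (h t).1) p) : ℕ) : ℝ)
  have hN : 0 ≤ N := Nat.cast_nonneg _
  have hterm : ∀ j, ∑ s ∈ roundsWith (fun t => (h t).1) p, slopeSign q j * d (h s).2 j ≤
      N * (if InWindow n q j then 4 * gridRate n q else 0) + n * bucketPotential n d h p q j := by
    intro j
    rw [sum_slopeSign_bucket (n := n)]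
    refine add_le_add le_rfl ?_
    have h1 : n * bucketPotential n d h p q j =
        Real.exp (gridRate n q * bucketGain n d h p q j) / gridRate n q := by
      unfold bucketPotential
      field_simp
    rw [h1, le_div_iff₀ hr]
    linarith [Real.add_one_le_exp (gridRate n q * bucketGain n d h p q j)]
  have hnonneg : ∀ j, 0 ≤ N * (if InWindow n q j then 4 * gridRate n q else 0) +
      n * bucketPotential n d h p q j := by
    intro j
    have := bucketPotential_nonneg hn d h p q j
    split_ifs <;> positivity
  calc _ ≤ ∑ j ∈ J, (N * (if InWindow n q j then 4 * gridRate n q else 0) +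
        n * bucketPotential n d h p q j) := Finset.sum_le_sum fun j _ => hterm j
    _ ≤ ∑ j ∈ Finset.range n, (N * (if InWindow n q j then 4 * gridRate n q else 0) +
        n * bucketPotential n d h p q j) :=
      Finset.sum_le_sum_of_subset_of_nonneg hJ fun j _ _ => hnonneg j
    _ = N * ∑ j ∈ Finset.range n, (if InWindow n q j then 4 * gridRate n q else 0) +
        n * ∑ j ∈ Finset.range n, bucketPotential n d h p q j := by
      rw [Finset.sum_add_distrib, ← Finset.mul_sum, ← Finset.mul_sum]
    _ ≤ _ := by nlinarith [sum_window_le hn q]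

/-- The regret of a grid prediction against an arbitrary report. -/
theorem sum_bucket_sub_le (hS : IsConvexLipschitzScore S) (h : Transcript Y T) (q : Fin n)
    (r : unitInterval) :
    ∑ s ∈ roundsWith (fun t => (h t).1) (gridPoint n q),
        (S (gridPoint n q) (h s).2 - S r (h s).2) ≤
      25 * (roundsWith (fun t => (h t).1) (gridPoint n q)).card / n +
        ∑ j ∈ Finset.range n, bucketPotential n (gridSlope S n) h (gridPoint n q) q j := by
  have hn : 0 < n := q.pos
  have hn' : (0 : ℝ) < n := by exact_mod_cast hn
  set R := roundsWith (fun t => (h t).1) (gridPoint n q)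
  have hrn : 0 ≤ (r : ℝ) * n := mul_nonneg r.2.1 hn'.le
  set m := ⌊(r : ℝ) * n⌋₊
  have hm1 : (m : ℝ) ≤ r * n := Nat.floor_le hrn
  have hm2 : (r : ℝ) * n < m + 1 := Nat.lt_floor_add_one _
  have hmn : m ≤ n := by
    have : (m : ℝ) ≤ n := hm1.trans (mul_le_of_le_one_left hn'.le r.2.2)
    exact_mod_cast this
  -- Rounding the comparator down to the grid adds `1 / n` per round, turning `24` into `25`.
  have hclose : ∀ y, S (m / n) y - S r y ≤ 1 / n := by
    intro y
    refine (le_abs_self _).trans ((hS.abs_sub_le y (natCast_div_mem_Icc hmn) r.2).trans ?_)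
    rw [abs_le]
    constructor
    · rw [neg_le_sub_iff_le_add, ← add_div, le_div_iff₀ hn']
      linarith
    · rw [sub_le_iff_le_add, div_le_iff₀ hn', add_mul, one_div_mul_cancel hn'.ne']
      linarith
  obtain ⟨J, hJ, hreg⟩ := exists_sum_slopeSign_eq q.isLt.le hmn
  have hgrid : n * ∑ s ∈ R, (S (gridPoint n q) (h s).2 - S (m / n) (h s).2) ≤
      24 * R.card + n * ∑ j ∈ Finset.range n,
        bucketPotential n (gridSlope S n) h (gridPoint n q) q j := by
    refine le_trans (le_of_eq ?_)
      (sum_slopeSign_bucket_le hn (gridSlope S n) h (gridPoint n q) q hJ)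
    rw [Finset.mul_sum, Finset.sum_comm]
    exact Finset.sum_congr rfl fun s _ => hreg S _
  have hround : ∑ s ∈ R, (S (m / n) (h s).2 - S r (h s).2) ≤ R.card * (1 / n) := by
    refine (Finset.sum_le_sum fun s _ => hclose (h s).2).trans ?_
    rw [Finset.sum_const, nsmul_eq_mul]
  have hsplit : ∑ s ∈ R, (S (gridPoint n q) (h s).2 - S r (h s).2) =
      ∑ s ∈ R, (S (gridPoint n q) (h s).2 - S (m / n) (h s).2) +
        ∑ s ∈ R, (S (m / n) (h s).2 - S r (h s).2) := by
    rw [← Finset.sum_add_distrib]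
    exact Finset.sum_congr rfl fun s _ => by ring
  rw [hsplit]
  refine le_of_mul_le_mul_left ?_ hn'
  calc _ ≤ 24 * (R.card : ℝ) + n * ∑ j ∈ Finset.range n,
        bucketPotential n (gridSlope S n) h (gridPoint n q) q j + n * (R.card * (1 / n)) := by
        rw [mul_add]
        exact add_le_add hgrid (mul_le_mul_of_nonneg_left hround hn'.le)
    _ = _ := by
      field_simp
      ring

theorem PMFExpect_outcomeDist (p : Fin T → unitInterval) (y : Fin T → Y) (q : unitInterval)
    (hq : q ∈ Finset.univ.image p) (f : Y → ℝ) :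
    PMFExpect (outcomeDist p y q hq) f =
      ((roundsWith p q).card : ℝ)⁻¹ * ∑ t ∈ roundsWith p q, f (y t) := by
  rw [outcomeDist, PMFExpect_map _ (Set.toFinite _), PMFExpect_eq_sum (s := roundsWith p q)]
  · rw [Finset.mul_sum]
    refine Finset.sum_congr rfl fun t ht => ?_
    rw [PMF.uniformOfFinset_apply_of_mem _ ht]
    simp
  · intro t ht
    exact Finset.mem_coe.2 ((PMF.mem_support_uniformOfFinset_iff _ _).1 ht)

theorem card_mul_subopt_le (p : Fin T → unitInterval) (y : Fin T → Y) (q : unitInterval)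
    (hq : q ∈ Finset.univ.image p) {B : ℝ}
    (hB : ∀ r : unitInterval, ∑ t ∈ roundsWith p q, (S q (y t) - S r (y t)) ≤ B) :
    ((roundsWith p q).card : ℝ) * subopt S (outcomeDist p y q hq) q ≤ B := by
  have hN : (0 : ℝ) < (roundsWith p q).card := by
    exact_mod_cast (roundsWith_nonempty p hq).card_pos
  unfold subopt
  simp only [PMFExpect_outcomeDist]
  have hinf : ((roundsWith p q).card : ℝ)⁻¹ * (∑ t ∈ roundsWith p q, S q (y t) - B) ≤
      ⨅ r : unitInterval, ((roundsWith p q).card : ℝ)⁻¹ * ∑ t ∈ roundsWith p q, S r (y t) := by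
    refine le_ciInf fun r => mul_le_mul_of_nonneg_left ?_ (inv_nonneg.2 hN.le)
    have := hB r
    rw [Finset.sum_sub_distrib] at this
    linarith
  have := mul_le_mul_of_nonneg_left hinf hN.le
  rw [mul_inv_cancel_left₀ hN.ne'] at this
  rw [mul_sub, mul_inv_cancel_left₀ hN.ne']
  linarith

theorem transcriptCAL_le (hn : 0 < n) (hS : IsConvexLipschitzScore S) (h : Transcript Y T)
    (hgrid : ∀ s, (h s).1 ∈ Set.range (gridPoint n)) :
    transcriptCAL S h ≤ 25 * T / n + potential n (gridPoint n) (gridSlope S n) h := by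
  set p : Fin T → unitInterval := fun t => (h t).1 with hp
  set B : Fin n → ℝ := fun q => 25 * (roundsWith p (gridPoint n q)).card / n +
    ∑ j ∈ Finset.range n, bucketPotential n (gridSlope S n) h (gridPoint n q) q j with hB
  have hB0 : ∀ q, 0 ≤ B q := fun q => add_nonneg (by positivity)
    (Finset.sum_nonneg fun j _ => bucketPotential_nonneg hn _ _ _ _ _)
  have hcard : ∑ q : Fin n, ((roundsWith p (gridPoint n q)).card : ℝ) = T := by
    have h1 := Finset.card_eq_sum_card_fiberwise (s := (Finset.univ : Finset (Fin T)))
      (t := Finset.univ.image (gridPoint n)) (f := p) (fun t _ => by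
        obtain ⟨q, hq⟩ := hgrid t
        simp only [Finset.coe_image, Finset.coe_univ, Set.image_univ]
        exact ⟨q, hq⟩)
    rw [Finset.sum_image (gridPoint_injective n).injOn, Finset.card_univ, Fintype.card_fin] at h1
    exact_mod_cast h1.symm
  have hsum : ∑ q, B q = 25 * T / n + potential n (gridPoint n) (gridSlope S n) h := by
    simp only [hB, Finset.sum_add_distrib, potential]
    rw [← Finset.sum_div, ← Finset.mul_sum, hcard]
  rw [← hsum]
  unfold transcriptCAL CAL
  -- Each distinct prediction is matched to its grid index by an indicator; swapping sums, unused
  -- indices only add nonnegative terms.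
  calc _ ≤ ∑ r ∈ (Finset.univ.image p).attach, ∑ q, (if gridPoint n q = r.1 then B q else 0) := by
        refine Finset.sum_le_sum fun r _ => ?_
        obtain ⟨t, -, ht⟩ := Finset.mem_image.1 r.2
        obtain ⟨q, hq⟩ := hgrid t
        have hqr : gridPoint n q = r.1 := hq.trans ht
        refine (card_mul_subopt_le p _ r.1 r.2 (B := B q) fun r' => ?_).trans ?_
        · have := sum_bucket_sub_le hS h q r'
          rw [← hqr]
          exact this
        · have := Finset.single_le_sum (f := fun q => if gridPoint n q = r.1 then B q else 0)
            (fun q _ => by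
              split_ifs
              exacts [hB0 q, le_rfl]) (Finset.mem_univ q)
          simpa only [hqr, if_true] using this
    _ = ∑ r ∈ Finset.univ.image p, ∑ q, (if gridPoint n q = r then B q else 0) :=
        Finset.sum_attach _ fun r => ∑ q, (if gridPoint n q = r then B q else 0)
    _ = ∑ q, ∑ r ∈ Finset.univ.image p, (if gridPoint n q = r then B q else 0) :=
        Finset.sum_comm
    _ ≤ _ := by
        refine Finset.sum_le_sum fun q _ => ?_
        rw [Finset.sum_ite_eq]
        split_ifs
        exacts [le_rfl, hB0 q]

end Transcript

/-! ### The guarantee -/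

theorem exists_guaranteesCAL_dyadic {Y : Type*} {S : ℝ → Y → ℝ} (hS : IsConvexLipschitzScore S)
    {K : ℕ} (hK : 2 ≤ K) (T : ℕ) : ∃ ρ : PredictionStrategy Y,
      GuaranteesCAL S T ρ (25 * T / 2 ^ K + 2 * ((K + 1) * 2 ^ K)) := by
  obtain ⟨ρ, hρ⟩ := exists_strategy_potential_le hK (gridPoint_injective _)
    (gridSlope_mem_slopeSet hS (2 ^ K))
  refine ⟨ρ, fun A => ?_⟩
  obtain ⟨hfin, hgrid, hle⟩ := hρ A T
  refine ⟨summable_toReal_mul_of_finite_support hfin _, ?_⟩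
  refine (PMFExpect_mono hfin fun h hh => transcriptCAL_le (by positivity) hS h
    (hgrid h hh)).trans ?_
  rw [PMFExpect_const_add hfin]
  push_cast
  linarith

/-- With `L = ⌊log₂ T⌋` and `K = L / 2 + 2`, `√T ≤ 2 ^ K ≤ 4 * √T`, so the two error terms balance
up to the logarithm. The shift by `2` also ensures `2 ≤ K`. -/
theorem exists_guaranteesCAL {Y : Type*} {S : ℝ → Y → ℝ} (hS : IsConvexLipschitzScore S)
    {T : ℕ} (hT : 2 ≤ T) :
    ∃ ρ : PredictionStrategy Y, GuaranteesCAL S T ρ (100 * Real.sqrt T * Real.log T) := by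
  set L := Nat.log 2 T
  set K := L / 2 + 2
  have hT0 : (0 : ℝ) < T := by
    have : 0 < T := by omega
    exact_mod_cast this
  have hL1 : 1 ≤ L := Nat.log_pos (by norm_num) hT
  have hpowle : (2 : ℝ) ^ L ≤ T := by exact_mod_cast Nat.pow_log_le_self 2 (by omega)
  have hltpow : (T : ℝ) < 2 ^ (L + 1) := by
    exact_mod_cast Nat.lt_pow_succ_log_self (by norm_num) T
  have hsq : ((2 : ℝ) ^ K) ^ 2 = 2 ^ (2 * K) := by rw [← pow_mul, mul_comm]
  have hlow : Real.sqrt T ≤ 2 ^ K := by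
    rw [Real.sqrt_le_left (by positivity), hsq]
    exact hltpow.le.trans (pow_le_pow_right₀ (by norm_num) (by omega))
  have hupp : (2 : ℝ) ^ K ≤ 4 * Real.sqrt T := by
    refine le_of_sq_le_sq ?_ (by positivity)
    rw [hsq, mul_pow, Real.sq_sqrt hT0.le]
    calc (2 : ℝ) ^ (2 * K) ≤ 2 ^ (L + 4) := pow_le_pow_right₀ (by norm_num) (by omega)
      _ = 2 ^ L * 16 := by rw [pow_add]; norm_num
      _ ≤ _ := by linarith
  have hlog2 : (0.69 : ℝ) < Real.log 2 := by linarith [Real.log_two_gt_d9]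
  have hlog : (L : ℝ) * 0.69 ≤ Real.log T := by
    have h1 := Real.log_le_log (by positivity) hpowle
    rw [Real.log_pow] at h1
    nlinarith [Nat.cast_nonneg (α := ℝ) L]
  have hK2 : (K : ℝ) + 1 ≤ 3.5 * L := by
    have h1 : 2 * (K + 1) ≤ 7 * L := by omega
    have h2 : (2 * (K + 1) : ℝ) ≤ 7 * L := by exact_mod_cast h1
    linarith
  have hL1' : (1 : ℝ) ≤ L := by exact_mod_cast hL1
  have hs0 := Real.sqrt_nonneg (T : ℝ)
  have hdiv : 25 * T / (2 : ℝ) ^ K ≤ 25 * Real.sqrt T := by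
    rw [div_le_iff₀ (by positivity)]
    nlinarith [Real.mul_self_sqrt hT0.le]
  obtain ⟨ρ, hρ⟩ := exists_guaranteesCAL_dyadic hS (show 2 ≤ K by omega) T
  refine ⟨ρ, fun A => ⟨(hρ A).1, (hρ A).2.trans ?_⟩⟩
  -- The total is at most `(25 + 28 * L) * √T ≤ 53 * L * √T`, and `53 / 0.69 < 100`.
  have h1 : ((K : ℝ) + 1) * 2 ^ K ≤ (3.5 * L) * (4 * Real.sqrt T) :=
    mul_le_mul hK2 hupp (by positivity) (by positivity)
  have h2 : Real.sqrt T ≤ Real.sqrt T * L := le_mul_of_one_le_right hs0 hL1'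
  have h3 := mul_le_mul_of_nonneg_left hlog hs0
  nlinarith

/-! ### Median and quantile scores -/

theorem isConvexLipschitzScore_medianScore : IsConvexLipschitzScore medianScore := by
  intro y
  refine ⟨?_, ?_⟩
  · have := (convexOn_norm (E := ℝ) convex_univ).translate_left (-(y : ℝ))
    refine (this.subset (Set.subset_univ _) (convex_Icc 0 1)).congr ?_
    intro p _
    simp [medianScore, sub_eq_add_neg]
  · refine LipschitzOnWith.of_dist_le_mul fun a _ b _ => ?_
    simp only [medianScore, Real.dist_eq, NNReal.coe_one, one_mul]
    calc _ ≤ |(a - y) - (b - y)| := abs_abs_sub_abs_le_abs_sub _ _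
      _ = _ := by ring_nf

theorem quantileScore_eq_max (q p : ℝ) (y : unitInterval) :
    quantileScore q p y = max (q * (y - p)) ((1 - q) * (p - y)) := by
  unfold quantileScore
  rcases lt_trichotomy p y with h | h | h
  · rw [if_pos h.le, if_neg (not_le.2 h), add_zero, max_eq_left]
    nlinarith
  · simp [h]
  · rw [if_neg (not_le.2 h), if_pos h.le, zero_add, max_eq_right]
    nlinarith

theorem isConvexLipschitzScore_quantileScore {q : ℝ} (h0 : 0 ≤ q) (h1 : q ≤ 1) :
    IsConvexLipschitzScore (quantileScore q) := by
  intro y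
  simp only [quantileScore_eq_max]
  refine ⟨?_, ?_⟩
  · refine ConvexOn.sup (f := fun p => q * ((y : ℝ) - p)) (g := fun p => (1 - q) * (p - y)) ?_ ?_
    · refine ⟨convex_Icc 0 1, fun a _ b _ s t _ _ hst => le_of_eq ?_⟩
      obtain rfl : t = 1 - s := by linarith
      simp only [smul_eq_mul]
      ring
    · refine ⟨convex_Icc 0 1, fun a _ b _ s t _ _ hst => le_of_eq ?_⟩
      obtain rfl : t = 1 - s := by linarith
      simp only [smul_eq_mul]
      ring
  · refine LipschitzOnWith.of_dist_le_mul fun a _ b _ => ?_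
    simp only [Real.dist_eq, NNReal.coe_one, one_mul]
    refine (abs_max_sub_max_le_max _ _ _ _).trans (max_le ?_ ?_)
    · rw [show q * ((y : ℝ) - a) - q * (y - b) = -(q * (a - b)) by ring, abs_neg, abs_mul,
        abs_of_nonneg h0]
      exact mul_le_of_le_one_left (abs_nonneg _) h1
    · rw [show (1 - q) * (a - (y : ℝ)) - (1 - q) * (b - y) = (1 - q) * (a - b) by ring, abs_mul,
        abs_of_nonneg (by linarith)]
      exact mul_le_of_le_one_left (abs_nonneg _) (by linarith)

theorem mainTheorem4 :
    ∃ C : ℝ, 0 < C ∧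
      (∀ (Y : Type*) (S : ℝ → Y → ℝ), IsConvexLipschitzScore S → ∀ T : ℕ, 2 ≤ T →
        ∃ ρ : PredictionStrategy Y, GuaranteesCAL S T ρ (C * Real.sqrt T * Real.log T)) ∧
      (∀ T : ℕ, 2 ≤ T →
        ∃ ρ : PredictionStrategy unitInterval,
          GuaranteesCAL medianScore T ρ (C * Real.sqrt T * Real.log T)) ∧
      (∀ q : ℝ, 0 ≤ q → q ≤ 1 → ∀ T : ℕ, 2 ≤ T →
        ∃ ρ : PredictionStrategy unitInterval,
          GuaranteesCAL (quantileScore q) T ρ (C * Real.sqrt T * Real.log T)) :=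
  ⟨100, by norm_num, fun _ _ hS _ hT => exists_guaranteesCAL hS hT,
    fun _ hT => exists_guaranteesCAL isConvexLipschitzScore_medianScore hT,
    fun _ h0 h1 _ hT => exists_guaranteesCAL (isConvexLipschitzScore_quantileScore h0 h1) hT⟩
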